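/- Let $R$ be an integral domain that is not a field, with quotient field $L$. An overring of $R$ is a ring $T$ with $R\subseteq T\subseteq L$. Suppose that $R$ is a Mori domain, i.e. $R$ satisfies the ascending chain condition on $v$-ideals, that is, on nonzero ideals $I$ of $R$ with $I=(I^{-1})^{-1}$, where $J^{-1}=\{x\in L : xJ\subseteq R\}$. Suppose also that $R$ is an FC-domain, i.e. every chain of distinct overrings of $R$ is finite. Let $\bar R$ be the complete integral closure of $R$, i.e. the set of all $x\in L$ for which there is a nonzero $r\in R$ with $rx^n\in R$ for all $n\ge 0$, and let $(R:\bar R)=\{x\in L : x\bar R\subseteq R\}$ be the conductor. Then: 1. $\bar R$ is a Dedekind domain, not a field, with only finitely many maximal ideals, and $(R:\bar R)\neq (0)$. 2. In particular, $R$ has Krull dimension $1$, and its valuative dimension $\dim_v R=\max\{\dim V : V \text{ a valuation overring of } R\}$ equals $1$. 3. If moreover $(R:\bar R)$ is a finitely generated ideal of $R$, then $R$ is Noetherian. -/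

import Mathlib

open scoped nonZeroDivisors

/-- A `v`-ideal (divisorial ideal) of `R`, whose quotient field is `K`: a nonzero ideal `I` with
`(I⁻¹)⁻¹ = I`, where `J⁻¹ = (R : J) = {x ∈ K | x J ⊆ R}`. -/
def IsVIdeal (R K : Type*) [CommRing R] [IsDomain R] [Field K] [Algebra R K] [IsFractionRing R K]
    (I : Ideal R) : Prop :=
  I ≠ ⊥ ∧ ((I : FractionalIdeal R⁰ K)⁻¹)⁻¹ = (I : FractionalIdeal R⁰ K)

/-- A Mori domain: every ascending chain of (integral) `v`-ideals is stationary. -/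
def IsMoriDomain (R K : Type*) [CommRing R] [IsDomain R] [Field K] [Algebra R K]
    [IsFractionRing R K] : Prop :=
  ∀ f : ℕ →o Ideal R, (∀ n, IsVIdeal R K (f n)) → ∃ n, ∀ m, n ≤ m → f m = f n

/-- An FC-domain: every chain of overrings of `R` is finite. The overrings of `R` are the subrings
of the quotient field `K` which contain `R`, that is, the `R`-subalgebras of `K`. -/
def IsFCDomain (R K : Type*) [CommRing R] [Field K] [Algebra R K] : Prop :=
  ∀ C : Set (Subalgebra R K), IsChain (· ≤ ·) C → C.Finite

/-- The conductor `(R : T) = {x ∈ K | x T ⊆ R}` of an overring `T` of `R`, as an `R`-submodule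
of `K`. -/
def overringConductor (R K : Type*) [CommRing R] [Field K] [Algebra R K] (T : Subalgebra R K) :
    Submodule R K :=
  (1 : Submodule R K) / Subalgebra.toSubmodule T

/-- The valuative dimension: the supremum of the Krull dimensions of the valuation overrings
of `R`. -/
noncomputable def valuativeDim (R K : Type*) [CommRing R] [Field K] [Algebra R K] : WithBot ℕ∞ :=
  ⨆ V : {V : Subalgebra R K // ValuationRing V}, ringKrullDim V.1

/-! Ascending chains make every overring a finitely generated `R`-algebra. So `R̄` has a common
denominator, i.e. the conductor `C = (R : R̄)` is nonzero, and `R̄` is integrally closed. Descending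
chains `R[x^(2^n)]` make each `x ∈ K` a root of a polynomial with a coefficient `1`, so finitely
generated nonzero ideals of `R̄` are invertible (`R̄` is Prüfer). For `c ∈ C` nonzero, `J ↦ cJ`
sends invertible ideals of `R̄` to `v`-ideals of `R`; the Mori condition then makes `R̄` Dedekind.
It is semilocal because `K = R[1/s]`.

The crux is that `R̄` is integral over `R` (`isIntegral_of_mem_completeIntegralClosure`). The Mori
condition makes `R/C` zero-dimensional; then, if a valuation nonnegative on `R` had a pole at `x ∈
R̄`, no polynomial with a coefficient `1` could vanish at `x`. Hence `R̄` is a finite `R`-module and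
`dim R = 1`; every valuation overring contains `R̄` and has dimension at most one. As `R̄` is a
semilocal PID, an Eakin–Nagata argument gives that `R` is Noetherian. -/

/-! ### Chain conditions on overrings -/

theorem IsFCDomain.wellFoundedGT {R K : Type*} [CommRing R] [Field K] [Algebra R K]
    (h : IsFCDomain R K) : WellFoundedGT (Subalgebra R K) :=
  ⟨RelEmbedding.wellFounded_iff_isEmpty.2 ⟨fun f => Set.infinite_range_of_injective f.injective <|
    h _ <| by
      rintro _ ⟨m, rfl⟩ _ ⟨n, rfl⟩ hne
      rcases lt_trichotomy m n with hmn | rfl | hmn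
      · exact Or.inl (f.map_rel_iff.2 hmn).le
      · exact absurd rfl hne
      · exact Or.inr (f.map_rel_iff.2 hmn).le⟩⟩

theorem IsFCDomain.wellFoundedLT {R K : Type*} [CommRing R] [Field K] [Algebra R K]
    (h : IsFCDomain R K) : WellFoundedLT (Subalgebra R K) :=
  ⟨RelEmbedding.wellFounded_iff_isEmpty.2 ⟨fun f => Set.infinite_range_of_injective f.injective <|
    h _ <| by
      rintro _ ⟨m, rfl⟩ _ ⟨n, rfl⟩ hne
      rcases lt_trichotomy m n with hmn | rfl | hmn
      · exact Or.inr (f.map_rel_iff.2 hmn).le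
      · exact absurd rfl hne
      · exact Or.inl (f.map_rel_iff.2 hmn).le⟩⟩

/-- Every overring of an FC-domain is a finitely generated algebra. -/
theorem IsFCDomain.fg {R K : Type*} [CommRing R] [Field K] [Algebra R K]
    (h : IsFCDomain R K) (S : Subalgebra R K) : S.FG := by
  obtain ⟨T, ⟨hTS, hT⟩, hmax⟩ := h.wellFoundedGT.wf.has_min
    {T : Subalgebra R K | T ≤ S ∧ T.FG} ⟨⊥, bot_le, Subalgebra.fg_bot⟩
  suffices S = T from this ▸ hT
  refine le_antisymm (fun x hx => ?_) hTS
  have hxS : Algebra.adjoin R {x} ≤ S := Algebra.adjoin_le (by simpa using hx)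
  have hfg : (T ⊔ Algebra.adjoin R {x}).FG := hT.sup (by
    simpa using Subalgebra.fg_adjoin_finset (R := R) {x})
  have := hmax _ ⟨sup_le hTS hxS, hfg⟩
  have h2 : T ⊔ Algebra.adjoin R {x} = T := by
    by_contra hne
    exact this (lt_of_le_of_ne le_sup_left (Ne.symm hne))
  rw [← h2]
  exact (le_sup_right : Algebra.adjoin R {x} ≤ _) (Algebra.self_mem_adjoin_singleton R x)

/-- Over an FC-domain every element of the quotient field is a root of a polynomial with
a coefficient equal to `1`. -/
theorem IsFCDomain.exists_aeval_eq_zero {R K : Type*} [CommRing R] [Field K] [Algebra R K]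
    (h : IsFCDomain R K) (x : K) :
    ∃ f : Polynomial R, Polynomial.aeval x f = 0 ∧ ∃ j, f.coeff j = 1 := by
  obtain ⟨_, ⟨n, rfl⟩, hmin⟩ := h.wellFoundedLT.wf.has_min
    (Set.range fun n : ℕ => Algebra.adjoin R {x ^ 2 ^ n}) (Set.range_nonempty _)
  have hx : x ^ 2 ^ n ∈ Algebra.adjoin R {x ^ 2 ^ (n + 1)} := by
    by_contra hx
    refine hmin _ ⟨n + 1, rfl⟩ (lt_of_le_of_ne (Algebra.adjoin_le ?_) fun he => hx ?_)
    · rw [Set.singleton_subset_iff, pow_succ, pow_mul]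
      exact pow_mem (Algebra.self_mem_adjoin_singleton R _) 2
    · simp only at he
      rw [he]
      exact Algebra.self_mem_adjoin_singleton R _
  rw [Algebra.adjoin_singleton_eq_range_aeval] at hx
  obtain ⟨p, hp⟩ := hx
  replace hp : Polynomial.aeval (x ^ 2 ^ (n + 1)) p = x ^ 2 ^ n := hp
  -- The expanded polynomial only has exponents divisible by `2 ^ (n + 1)`, so it cannot touch the
  -- coefficient of `X ^ 2 ^ n`.
  refine ⟨Polynomial.X ^ 2 ^ n - Polynomial.expand R (2 ^ (n + 1)) p, ?_, 2 ^ n, ?_⟩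
  · simp [Polynomial.expand_aeval, hp]
  · have h1 : ¬ 2 ^ (n + 1) ∣ 2 ^ n := fun hd => by
      have := Nat.le_of_dvd (by positivity) hd
      rw [pow_succ] at this
      have : 0 < 2 ^ n := by positivity
      omega
    rw [Polynomial.coeff_sub, Polynomial.coeff_X_pow_self, Polynomial.coeff_expand (by positivity),
      if_neg h1, sub_zero]

/-! ### Invertibility of finitely generated ideals -/

/-- If `A` is integrally closed in `K` and `x ∈ K` is a root of `f ∈ A[X]`, then the coefficients
of `f` lie in `𝔟 + 𝔟 x`, where `𝔟 = {b ∈ A | b x ∈ A}`. -/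
theorem exists_eq_add_mul_of_aeval_eq_zero {A K : Type*} [CommRing A] [Field K] [Algebra A K]
    [FaithfulSMul A K] (hA : ∀ y : K, IsIntegral A y → y ∈ (algebraMap A K).range) (x : K) (n : ℕ)
    (f : Polynomial A) (hn : f.natDegree ≤ n) (hf : Polynomial.aeval x f = 0) (j : ℕ) :
    ∃ b b' : K, (b ∈ (algebraMap A K).range ∧ b * x ∈ (algebraMap A K).range) ∧
      (b' ∈ (algebraMap A K).range ∧ b' * x ∈ (algebraMap A K).range) ∧
      b + b' * x = algebraMap A K (f.coeff j) := by
  induction n generalizing f j with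
  | zero =>
    rw [Nat.le_zero, Polynomial.natDegree_eq_zero] at hn
    obtain ⟨c, rfl⟩ := hn
    have hc : c = 0 := by simpa using hf
    exact ⟨0, 0, by simp [zero_mem], by simp [zero_mem], by simp [hc]⟩
  | succ n ih =>
    set c := f.coeff (n + 1) with hc
    have hint : algebraMap A K c * x ∈ (algebraMap A K).range := by
      by_cases h0 : c = 0
      · simp [h0, zero_mem]
      · have hdeg : f.natDegree = n + 1 := le_antisymm hn (Polynomial.le_natDegree_of_ne_zero h0)
        refine hA _ ?_
        have := isIntegral_leadingCoeff_smul f x hf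
        rwa [Polynomial.leadingCoeff, hdeg, ← hc, Algebra.smul_def] at this
    obtain ⟨d, hd⟩ := hint
    -- Since `d = c x`, trading `c X^(n+1)` for `d X^n` keeps the root and lowers the degree bound.
    set g := f - Polynomial.monomial (n + 1) c + Polynomial.monomial n d with hg
    have hgn : g.natDegree ≤ n := by
      rw [Polynomial.natDegree_le_iff_coeff_eq_zero]
      intro N hN
      rcases Nat.lt_or_ge (n + 1) N with h | h
      · simp [hg, Polynomial.coeff_monomial, hN.ne, h.ne,
          Polynomial.coeff_eq_zero_of_natDegree_lt (lt_of_le_of_lt hn h)]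
      · obtain rfl : N = n + 1 := by omega
        simp [hg, Polynomial.coeff_monomial, hc]
    have hgx : Polynomial.aeval x g = 0 := by
      simp only [hg, map_add, map_sub, hf, Polynomial.aeval_monomial, hd]
      ring
    by_cases hj : j = n + 1
    · subst hj
      exact ⟨algebraMap A K c, 0, ⟨⟨c, rfl⟩, ⟨d, hd⟩⟩, by simp [zero_mem], by simp [hc]⟩
    · obtain ⟨b, b', hb, hb', he⟩ := ih g hgn hgx j
      by_cases hjn : j = n
      · subst hjn
        refine ⟨b, b' - algebraMap A K c, hb,
          ⟨sub_mem hb'.1 ⟨c, rfl⟩, ?_⟩, ?_⟩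
        · rw [sub_mul]
          exact sub_mem hb'.2 ⟨d, hd⟩
        · have : g.coeff j = f.coeff j + d := by simp [hg, Polynomial.coeff_monomial]
          rw [this, map_add, hd] at he
          linear_combination he
      · refine ⟨b, b', hb, hb', ?_⟩
        rw [he]
        simp [hg, Polynomial.coeff_monomial, Ne.symm hj, Ne.symm hjn]

section Invertible

variable {A K : Type*} [CommRing A] [Field K] [Algebra A K] [IsFractionRing A K]

open FractionalIdeal

theorem isUnit_one_add_spanSingleton (hA : ∀ y : K, IsIntegral A y → y ∈ (algebraMap A K).range)
    {x : K} {f : Polynomial A} (hf : Polynomial.aeval x f = 0) {j : ℕ} (hj : f.coeff j = 1) :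
    IsUnit (1 + spanSingleton A⁰ x : FractionalIdeal A⁰ K) := by
  obtain ⟨b, b', hb, hb', he⟩ := exists_eq_add_mul_of_aeval_eq_zero hA x _ f le_rfl hf j
  rw [hj, map_one] at he
  -- The product with `(1, x)` is generated by `b, bx, b', b'x ∈ A` and contains `b + b'x = 1`.
  refine IsUnit.of_mul_eq_one (spanSingleton A⁰ b + spanSingleton A⁰ b') (le_antisymm ?_ ?_)
  · simp only [add_mul, mul_add, one_mul, spanSingleton_mul_spanSingleton]
    simp only [← sup_eq_add, sup_le_iff, spanSingleton_le_iff_mem, mem_one_iff]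
    exact ⟨⟨hb.1, by simpa [mul_comm] using hb.2⟩, hb'.1, by simpa [mul_comm] using hb'.2⟩
  · have hle (I J : FractionalIdeal A⁰ K) : I ≤ I + J ∧ J ≤ I + J := by
      rw [← sup_eq_add]
      exact ⟨le_sup_left, le_sup_right⟩
    have h1 := mul_mem_mul ((hle 1 (spanSingleton A⁰ x)).1 (one_mem_one A⁰))
      ((hle (spanSingleton A⁰ b) (spanSingleton A⁰ b')).1 (mem_spanSingleton_self A⁰ b))
    have h2 := mul_mem_mul ((hle 1 (spanSingleton A⁰ x)).2 (mem_spanSingleton_self A⁰ x))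
      ((hle (spanSingleton A⁰ b) (spanSingleton A⁰ b')).2 (mem_spanSingleton_self A⁰ b'))
    have h3 := Submodule.add_mem _ h1 h2
    rw [one_mul, mul_comm x, he] at h3
    exact FractionalIdeal.one_le.2 h3

theorem isUnit_spanSingleton_add_spanSingleton
    (h : ∀ x : K, IsUnit (1 + spanSingleton A⁰ x : FractionalIdeal A⁰ K)) {a : K} (b : K)
    (ha : a ≠ 0) : IsUnit (spanSingleton A⁰ a + spanSingleton A⁰ b) := by
  have h1 : IsUnit (spanSingleton A⁰ a) :=
    IsUnit.of_mul_eq_one (spanSingleton A⁰ a⁻¹) (by simp [spanSingleton_mul_spanSingleton, ha])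
  have := h1.mul (h (a⁻¹ * b))
  rwa [mul_add, mul_one, spanSingleton_mul_spanSingleton, mul_inv_cancel_left₀ ha] at this

/-- Induction through `(I+J+L)(IJ+JL+IL) = (I+J)(I+L)(J+L)`: a factor of an invertible ideal is
invertible. -/
theorem isUnit_sum_spanSingleton
    (h : ∀ x : K, IsUnit (1 + spanSingleton A⁰ x : FractionalIdeal A⁰ K)) (n : ℕ) (x : ℕ → K)
    (hx : ∀ i, x i ≠ 0) :
    IsUnit (∑ i ∈ Finset.range (n + 1), spanSingleton A⁰ (x i)) := by
  induction n using Nat.strong_induction_on generalizing x with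
  | _ n ih =>
    match n, ih with
    | 0, _ =>
      simpa [← sup_eq_add] using isUnit_spanSingleton_add_spanSingleton h (x 0) (hx 0)
    | 1, _ =>
      simpa [Finset.sum_range_succ] using isUnit_spanSingleton_add_spanSingleton h (x 1) (hx 0)
    | n + 2, ih =>
      have hAB := ih (n + 1) (by omega) x hx
      -- The last generator is swapped for `x (n + 2)`, which gives `I + L`.
      have hAC := ih (n + 1) (by omega) (fun i => if i = n + 1 then x (n + 2) else x i) fun i => by
        split_ifs <;> exact hx _
      have hBC := isUnit_spanSingleton_add_spanSingleton h (x (n + 2)) (hx (n + 1))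
      have h2 : ∑ i ∈ Finset.range (n + 1),
          spanSingleton A⁰ (if i = n + 1 then x (n + 2) else x i) =
          ∑ i ∈ Finset.range (n + 1), spanSingleton A⁰ (x i) :=
        Finset.sum_congr rfl fun i hi => by
          rw [if_neg (by have := Finset.mem_range.1 hi; omega)]
      rw [Finset.sum_range_succ] at hAB
      rw [Finset.sum_range_succ, h2, if_pos rfl] at hAC
      rw [Finset.sum_range_succ, Finset.sum_range_succ]
      generalize ∑ i ∈ Finset.range (n + 1), spanSingleton A⁰ (x i) = I at *
      generalize spanSingleton A⁰ (x (n + 1)) = J at *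
      generalize spanSingleton A⁰ (x (n + 2)) = L at *
      have key : (I + J + L) * (I * J + J * L + I * L) = (I + J) * (I + L) * (J + L) := by
        -- The two sides differ only in the multiplicity of `IJL` (three against two), and addition
        -- of ideals is idempotent.
        have : I * J * L + I * J * L = I * J * L := by rw [← sup_eq_add, sup_idem]
        calc _ = I * I * J + I * I * L + I * J * J + J * J * L + I * L * L + J * L * L +
              ((I * J * L + I * J * L) + I * J * L) := by ring
          _ = I * I * J + I * I * L + I * J * J + J * J * L + I * L * L + J * L * L +
              (I * J * L + I * J * L) := by rw [this, this]
          _ = _ := by ring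
      exact isUnit_of_mul_isUnit_left (key ▸ (hAB.mul hAC).mul hBC)

open Classical in
theorem isUnit_coeIdeal_of_fg
    (h : ∀ x : K, IsUnit (1 + spanSingleton A⁰ x : FractionalIdeal A⁰ K)) {J : Ideal A}
    (hJ : J.FG) (hJ0 : J ≠ ⊥) : IsUnit (J : FractionalIdeal A⁰ K) := by
  obtain ⟨n, s, hs⟩ := Submodule.fg_iff_exists_fin_generating_family.1 hJ
  obtain ⟨a, haJ, ha0⟩ := Submodule.exists_mem_ne_zero_of_ne_bot hJ0
  -- Zero generators and indices out of range are replaced by the nonzero `a ∈ J`.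
  set x : ℕ → A := fun i => if hi : ∃ hi : i < n, s ⟨i, hi⟩ ≠ 0 then s ⟨i, hi.1⟩ else a with hx
  have hxJ (i) : x i ∈ J := by
    simp only [hx]
    split_ifs with hi
    · exact hs ▸ Submodule.subset_span ⟨_, rfl⟩
    · exact haJ
  have hx0 (i) : x i ≠ 0 := by
    simp only [hx]
    split_ifs with hi
    · exact hi.2
    · exact ha0
  have hsum : ∑ i ∈ Finset.range (n + 1), Ideal.span {x i} = J := by
    refine le_antisymm ?_ ?_
    · rw [Ideal.sum_eq_sup, Finset.sup_le_iff]
      exact fun i _ => (Ideal.span_singleton_le_iff_mem _).2 (hxJ i)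
    · rw [Ideal.sum_eq_sup, ← hs, Submodule.span_le]
      rintro _ ⟨⟨i, hi⟩, rfl⟩
      by_cases h0 : s ⟨i, hi⟩ = 0
      · rw [h0]
        exact zero_mem _
      · refine Finset.le_sup (f := fun i => Ideal.span {x i})
          (Finset.mem_range.2 (Nat.lt_succ_of_lt hi)) ?_
        have : x i = s ⟨i, hi⟩ := dif_pos ⟨hi, h0⟩
        rw [← this]
        exact Ideal.mem_span_singleton_self _
  have := isUnit_sum_spanSingleton h n (fun i => algebraMap A K (x i)) fun i =>
    (map_ne_zero_iff _ (IsFractionRing.injective A K)).2 (hx0 i)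
  simp only [← coeIdeal_span_singleton] at this
  rwa [← hsum, ← coeIdealHom_apply, map_sum]

end Invertible

/-! ### The conductor and the complete integral closure -/

instance Subalgebra.isFractionRing_of_isFractionRing {R K : Type*} [CommRing R] [Field K]
    [Algebra R K] [IsFractionRing R K] (S : Subalgebra R K) : IsFractionRing S K := by
  refine IsFractionRing.of_field S K fun z => ?_
  obtain ⟨a, b, -, rfl⟩ := IsFractionRing.div_surjective (A := R) z
  exact ⟨algebraMap R S a, algebraMap R S b, rfl⟩

theorem mem_overringConductor {R K : Type*} [CommRing R] [Field K] [Algebra R K]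
    {T : Subalgebra R K} {x : K} :
    x ∈ overringConductor R K T ↔ ∀ y ∈ T, x * y ∈ (algebraMap R K).range := by
  simp only [overringConductor, Submodule.mem_div_iff_forall_mul_mem, Subalgebra.mem_toSubmodule,
    Submodule.mem_one, RingHom.mem_range]

theorem mem_range_of_mem_overringConductor {R K : Type*} [CommRing R] [Field K] [Algebra R K]
    {T : Subalgebra R K} {x : K} (hx : x ∈ overringConductor R K T) :
    x ∈ (algebraMap R K).range := by
  simpa using mem_overringConductor.1 hx 1 (one_mem T)

theorem mul_mem_overringConductor {R K : Type*} [CommRing R] [Field K] [Algebra R K]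
    {T : Subalgebra R K} {x y : K} (hx : x ∈ overringConductor R K T) (hy : y ∈ T) :
    x * y ∈ overringConductor R K T :=
  mem_overringConductor.2 fun z hz => by
    rw [mul_assoc]
    exact mem_overringConductor.1 hx _ (mul_mem hy hz)

section

variable {R K : Type*} [CommRing R] [IsDomain R] [Field K] [Algebra R K] [IsFractionRing R K]

omit [IsFractionRing R K] in
theorem exists_smul_closure_mem_range (t : Finset K) (ht : ∀ x ∈ t, IsAlmostIntegral R x) :
    ∃ r : R, r ≠ 0 ∧ ∀ m ∈ Submonoid.closure (t : Set K), r • m ∈ (algebraMap R K).range := by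
  classical
  induction t using Finset.induction_on with
  | empty =>
    refine ⟨1, one_ne_zero, fun m hm => ?_⟩
    rw [Finset.coe_empty, Submonoid.closure_empty, Submonoid.mem_bot] at hm
    simp [hm, one_mem]
  | insert a t _ ih =>
    obtain ⟨r, hr, h⟩ := ih fun x hx => ht x (Finset.mem_insert_of_mem hx)
    obtain ⟨s, hs, h'⟩ := ht a (Finset.mem_insert_self a t)
    refine ⟨s * r, mul_ne_zero (nonZeroDivisors.ne_zero hs) hr, fun m hm => ?_⟩
    rw [Finset.coe_insert, Set.insert_eq, Submonoid.closure_union, Submonoid.mem_sup] at hm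
    obtain ⟨y, hy, z, hz, rfl⟩ := hm
    obtain ⟨n, rfl⟩ := Submonoid.mem_closure_singleton.1 hy
    rw [← smul_mul_smul_comm]
    exact mul_mem (h' n) (h z hz)

/-- The conductor of a finitely generated algebra of almost integral elements is nonzero. -/
theorem exists_mem_overringConductor_ne_zero {T : Subalgebra R K} (hT : T.FG)
    (h : T ≤ completeIntegralClosure R K) : ∃ c ∈ overringConductor R K T, c ≠ 0 := by
  obtain ⟨t, rfl⟩ := hT
  obtain ⟨r, hr, hrt⟩ := exists_smul_closure_mem_range (R := R) t fun x hx =>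
    h (Algebra.subset_adjoin hx)
  refine ⟨algebraMap R K r, mem_overringConductor.2 fun y hy => ?_,
    (map_ne_zero_iff _ (IsFractionRing.injective R K)).2 hr⟩
  rw [← Algebra.smul_def]
  rw [← Subalgebra.mem_toSubmodule, Algebra.adjoin_eq_span] at hy
  induction hy using Submodule.span_induction with
  | mem x hx => exact hrt x hx
  | zero => simp [zero_mem]
  | add x y _ _ hx hy => rw [smul_add]; exact add_mem hx hy
  | smul a x _ hx =>
    rw [smul_comm, Algebra.smul_def]
    exact mul_mem ⟨a, rfl⟩ hx

omit [IsFractionRing R K] in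
theorem mem_completeIntegralClosure_of_mul_mem {c x : K} (hc0 : c ≠ 0)
    (hc : c ∈ (algebraMap R K).range) (h : ∀ n, c * x ^ n ∈ (algebraMap R K).range) :
    x ∈ completeIntegralClosure R K := by
  obtain ⟨r, rfl⟩ := hc
  refine mem_completeIntegralClosure.2 ⟨r, mem_nonZeroDivisors_of_ne_zero ?_, fun n => ?_⟩
  · rintro rfl
    simp at hc0
  · rw [Algebra.smul_def]
    exact h n

-- As `C` is an ideal of `R̄`, `xC ⊆ R` forces `xC ⊆ C`, hence `c xⁿ ∈ C ⊆ R` for all `n`. Thus `(R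
-- : C) ⊆ R̄`.
omit [IsFractionRing R K] in
theorem mem_completeIntegralClosure_of_forall_mul_mem {c x : K} (hc0 : c ≠ 0)
    (hc : c ∈ overringConductor R K (completeIntegralClosure R K))
    (h : ∀ t ∈ overringConductor R K (completeIntegralClosure R K),
      x * t ∈ (algebraMap R K).range) : x ∈ completeIntegralClosure R K := by
  have hx (t : K) (ht : t ∈ overringConductor R K (completeIntegralClosure R K)) :
      t * x ∈ overringConductor R K (completeIntegralClosure R K) :=
    mem_overringConductor.2 fun y hy => by
      have := h _ (mul_mem_overringConductor ht hy)
      rwa [mul_comm t, mul_assoc]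
  have hn (n : ℕ) : c * x ^ n ∈ overringConductor R K (completeIntegralClosure R K) := by
    induction n with
    | zero => simpa using hc
    | succ n ih => rw [pow_succ, ← mul_assoc]; exact hx _ ih
  exact mem_completeIntegralClosure_of_mul_mem hc0 (mem_range_of_mem_overringConductor hc)
    fun n => mem_range_of_mem_overringConductor (hn n)

/-- If `d ∈ R̄` is a denominator over `R̄` for all powers of `x`, then `c d` is one over `R`. -/
theorem mem_completeIntegralClosure_of_isIntegral {c x : K} (hc0 : c ≠ 0)
    (hc : c ∈ overringConductor R K (completeIntegralClosure R K))
    (hx : IsIntegral (completeIntegralClosure R K) x) : x ∈ completeIntegralClosure R K := by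
  obtain ⟨d, hd, h⟩ := hx.isAlmostIntegral
  have hcd : c * (d : K) ∈ overringConductor R K (completeIntegralClosure R K) :=
    mul_mem_overringConductor hc d.2
  refine mem_completeIntegralClosure_of_mul_mem
    (mul_ne_zero hc0 fun h0 => nonZeroDivisors.ne_zero hd (Subtype.ext h0))
    (mem_range_of_mem_overringConductor hcd) fun n => ?_
  obtain ⟨y, hy⟩ := h n
  have : c * (d : K) * x ^ n = c * (y : K) := by
    rw [mul_assoc]
    congr 1
    exact hy.symm
  rw [this]
  exact mem_overringConductor.1 hc _ y.2

/-! ### Divisorial ideals and the Dedekind property -/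

/-- Here `I = R ∩ (R : S)`, so `1` and `S` lie in `I⁻¹`; anything multiplying `I⁻¹` into `R` is
therefore in `I`. -/
theorem isVIdeal_of_mem_iff {I : Ideal R} (hI : I ≠ ⊥) (S : Set K)
    (h : ∀ r, r ∈ I ↔ ∀ y ∈ S, algebraMap R K r * y ∈ (algebraMap R K).range) :
    IsVIdeal R K I := by
  have hI0 : (I : FractionalIdeal R⁰ K) ≠ 0 := FractionalIdeal.coeIdeal_ne_zero.2 hI
  have h1 : (1 : K) ∈ (I : FractionalIdeal R⁰ K)⁻¹ := by
    rw [FractionalIdeal.mem_inv_iff hI0]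
    intro y hy
    rw [one_mul]
    exact FractionalIdeal.coeIdeal_le_one hy
  have hI1 : (I : FractionalIdeal R⁰ K)⁻¹ ≠ 0 := fun h0 => by
    rw [h0, FractionalIdeal.mem_zero_iff] at h1
    exact one_ne_zero h1
  refine ⟨hI, le_antisymm (fun x hx => ?_) fun x hx => ?_⟩
  · have hx' := (FractionalIdeal.mem_inv_iff hI1).1 hx
    obtain ⟨r, hr⟩ := (FractionalIdeal.mem_one_iff _).1 (hx' 1 h1)
    rw [mul_one] at hr
    subst hr
    refine FractionalIdeal.mem_coeIdeal_of_mem _ ((h r).2 fun y hy => ?_)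
    refine (FractionalIdeal.mem_one_iff _).1 (hx' y ?_)
    rw [FractionalIdeal.mem_inv_iff hI0]
    intro z hz
    obtain ⟨i, hi, rfl⟩ := (FractionalIdeal.mem_coeIdeal _).1 hz
    rw [mul_comm]
    exact (FractionalIdeal.mem_one_iff _).2 ((h i).1 hi y hy)
  · rw [FractionalIdeal.mem_inv_iff hI1]
    intro y hy
    rw [mul_comm]
    exact (FractionalIdeal.mem_inv_iff hI0).1 hy x hx

/-- The ideal `c J ∩ R` of `R`, for an ideal `J` of an overring. -/
def scaledContraction (c : K) {T : Subalgebra R K} (J : Ideal T) : Ideal R where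
  carrier := {r | ∃ j ∈ J, algebraMap R K r = c * (j : K)}
  zero_mem' := ⟨0, zero_mem J, by simp⟩
  add_mem' := by
    rintro a b ⟨i, hi, hai⟩ ⟨j, hj, hbj⟩
    exact ⟨i + j, add_mem hi hj, by simp [hai, hbj, mul_add]⟩
  smul_mem' := by
    rintro a b ⟨i, hi, hai⟩
    refine ⟨algebraMap R T a * i, J.mul_mem_left _ hi, ?_⟩
    rw [smul_eq_mul, map_mul, hai, mul_left_comm]
    rfl

omit [IsDomain R] [IsFractionRing R K] in
theorem mem_scaledContraction {c : K} {T : Subalgebra R K} {J : Ideal T} {r : R} :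
    r ∈ scaledContraction c J ↔ ∃ j ∈ J, algebraMap R K r = c * (j : K) := Iff.rfl

omit [IsDomain R] [IsFractionRing R K] in
theorem scaledContraction_le_iff {c : K} (hc0 : c ≠ 0) {T : Subalgebra R K}
    (hc : c ∈ overringConductor R K T) {I J : Ideal T} :
    scaledContraction c I ≤ scaledContraction c J ↔ I ≤ J := by
  refine ⟨fun h x hx => ?_, fun h r ⟨j, hj, hr⟩ => ⟨j, h hj, hr⟩⟩
  obtain ⟨r, hr⟩ := mem_overringConductor.1 hc x x.2
  obtain ⟨j, hj, hj'⟩ := h (mem_scaledContraction.2 ⟨x, hx, hr⟩)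
  rw [hr] at hj'
  rwa [Subtype.ext (mul_left_cancel₀ hc0 hj')]

/-- With `C = (R : D)`, the test set is `c⁻¹ J⁻¹ C`: by `hD`, `r c⁻¹ J⁻¹ C ⊆ R` gives `r c⁻¹ J⁻¹ ⊆
D`, so `r c⁻¹ ∈ (J⁻¹)⁻¹ = J`. -/
theorem isVIdeal_scaledContraction {D : Subalgebra R K}
    (hD : ∀ x : K, (∀ t ∈ overringConductor R K D, x * t ∈ (algebraMap R K).range) → x ∈ D)
    {c : K} (hc0 : c ≠ 0) (hc : c ∈ overringConductor R K D)
    {J : Ideal D} (hJ : IsUnit (J : FractionalIdeal D⁰ K)) (hJ0 : J ≠ ⊥) :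
    IsVIdeal R K (scaledContraction c J) := by
  have hmul : (J : FractionalIdeal D⁰ K)⁻¹ * J = 1 := by
    rw [mul_comm]
    exact (FractionalIdeal.mul_inv_cancel_iff_isUnit K).2 hJ
  have hinv : (J : FractionalIdeal D⁰ K) = ((J : FractionalIdeal D⁰ K)⁻¹)⁻¹ :=
    FractionalIdeal.right_inverse_eq K _ _ hmul
  have hne : (J : FractionalIdeal D⁰ K)⁻¹ ≠ 0 := left_ne_zero_of_mul (hmul ▸ one_ne_zero)
  have hne' : (J : FractionalIdeal D⁰ K) ≠ 0 := right_ne_zero_of_mul (hmul ▸ one_ne_zero)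
  refine isVIdeal_of_mem_iff ?_
    {z | ∃ y ∈ (J : FractionalIdeal D⁰ K)⁻¹, ∃ t ∈ overringConductor R K D, z = c⁻¹ * y * t}
    fun r => ⟨?_, fun h => ?_⟩
  · intro h
    refine hJ0 (le_bot_iff.1 ((scaledContraction_le_iff hc0 hc).1 ?_))
    rw [h]
    exact bot_le
  · rintro ⟨j, hj, hr⟩ _ ⟨y, hy, t, ht, rfl⟩
    obtain ⟨d, hd⟩ := (FractionalIdeal.mem_one_iff _).1
      ((FractionalIdeal.mem_inv_iff hne').1 hy j (FractionalIdeal.mem_coeIdeal_of_mem _ hj))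
    have hd' : (d : K) = y * j := hd
    have : algebraMap R K r * (c⁻¹ * y * t) = t * d := by
      rw [hr, hd']
      field_simp
    rw [this]
    exact mem_overringConductor.1 ht _ d.2
  · have hmem : c⁻¹ * algebraMap R K r ∈ (J : FractionalIdeal D⁰ K) := by
      rw [hinv, FractionalIdeal.mem_inv_iff hne]
      intro y hy
      rw [FractionalIdeal.mem_one_iff]
      refine ⟨⟨c⁻¹ * algebraMap R K r * y,
        hD _ fun t ht => ?_⟩, rfl⟩
      have := h _ ⟨y, hy, t, ht, rfl⟩
      convert this using 1
      ring
    obtain ⟨j, hj, hj'⟩ := (FractionalIdeal.mem_coeIdeal _).1 hmem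
    refine ⟨j, hj, ?_⟩
    have hj' : (j : K) = c⁻¹ * algebraMap R K r := hj'
    rw [hj', mul_inv_cancel_left₀ hc0]

/-- A Mori domain has the ascending chain condition on ideals of its complete integral closure
which are invertible, if the conductor is nonzero. -/
theorem IsMoriDomain.isDedekindDomain_completeIntegralClosure (hM : IsMoriDomain R K) {c : K}
    (hc0 : c ≠ 0) (hc : c ∈ overringConductor R K (completeIntegralClosure R K))
    (hinv : ∀ J : Ideal (completeIntegralClosure R K), J.FG → J ≠ ⊥ →
      IsUnit (J : FractionalIdeal (completeIntegralClosure R K)⁰ K)) :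
    IsDedekindDomain (completeIntegralClosure R K) := by
  set D := completeIntegralClosure R K
  have hwf : WellFoundedGT {J : Ideal D // J.FG ∧ J ≠ ⊥} := by
    rw [wellFoundedGT_iff_monotone_chain_condition]
    intro g
    obtain ⟨n, hn⟩ := hM ⟨fun n => scaledContraction c (g n).1,
      fun m n hmn => (scaledContraction_le_iff hc0 hc).2 (g.monotone hmn)⟩
      fun n => isVIdeal_scaledContraction
        (fun x => mem_completeIntegralClosure_of_forall_mul_mem hc0 hc) hc0 hc (hinv _ (g n).2.1 (g n).2.2) (g n).2.2
    exact ⟨n, fun m hm => Subtype.ext <| le_antisymm (g.monotone hm)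
      ((scaledContraction_le_iff hc0 hc).1 (hn m hm).le)⟩
  -- A maximal finitely generated nonzero ideal inside `J` must be `J`.
  have hfg (J : Ideal D) (hJ : J ≠ ⊥) : J.FG := by
    obtain ⟨a, haJ, ha0⟩ := Submodule.exists_mem_ne_zero_of_ne_bot hJ
    obtain ⟨⟨I, hI, hI0⟩, hIJ, hmax⟩ := hwf.wf.has_min
      {I : {J : Ideal D // J.FG ∧ J ≠ ⊥} | I.1 ≤ J}
      ⟨⟨Ideal.span {a}, ⟨{a}, by simp⟩, by simpa using ha0⟩, by simpa using haJ⟩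
    suffices I = J from this ▸ hI
    refine le_antisymm hIJ fun x hx => ?_
    have hle : I ≤ I ⊔ Ideal.span {x} := le_sup_left
    by_contra hxI
    refine hmax ⟨I ⊔ Ideal.span {x}, Submodule.FG.sup hI ⟨{x}, by simp⟩, fun h => hI0 (le_bot_iff.1 (h ▸ hle))⟩
      (sup_le hIJ ((Ideal.span_singleton_le_iff_mem _).2 hx)) (lt_of_le_of_ne hle fun he => hxI ?_)
    have he : I = I ⊔ Ideal.span {x} := congrArg Subtype.val he
    rw [he]
    exact (le_sup_right : Ideal.span {x} ≤ _) (Ideal.mem_span_singleton_self x)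
  rw [isDedekindDomain_iff_mul_inv_cancel (K := K)]
  intro I hI
  obtain ⟨a, J, ha, rfl⟩ := FractionalIdeal.exists_eq_spanSingleton_mul I
  rw [FractionalIdeal.mul_inv_cancel_iff_isUnit]
  have ha' : algebraMap D K a ≠ 0 := (map_ne_zero_iff _ (IsFractionRing.injective D K)).2 ha
  refine (IsUnit.of_mul_eq_one (FractionalIdeal.spanSingleton D⁰ (algebraMap D K a)) ?_).mul ?_
  · rw [FractionalIdeal.spanSingleton_mul_spanSingleton, inv_mul_cancel₀ ha',
      FractionalIdeal.spanSingleton_one]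
  · have hJ : J ≠ ⊥ := FractionalIdeal.coeIdeal_ne_zero.1 (right_ne_zero_of_mul hI)
    exact hinv J (hfg J hJ) hJ

theorem IsFCDomain.exists_mem_overringConductor_ne_zero (h : IsFCDomain R K) :
    ∃ c ∈ overringConductor R K (completeIntegralClosure R K), c ≠ 0 :=
  _root_.exists_mem_overringConductor_ne_zero (h.fg _) le_rfl

theorem isDedekindDomain_completeIntegralClosure (hM : IsMoriDomain R K) (h : IsFCDomain R K) :
    IsDedekindDomain (completeIntegralClosure R K) := by
  obtain ⟨c, hc, hc0⟩ := h.exists_mem_overringConductor_ne_zero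
  refine hM.isDedekindDomain_completeIntegralClosure hc0 hc fun J =>
    isUnit_coeIdeal_of_fg fun x => ?_
  obtain ⟨f, hf, j, hj⟩ := h.exists_aeval_eq_zero x
  refine isUnit_one_add_spanSingleton (f := f.map (algebraMap R _)) (j := j) (fun y hy => ?_)
    (by simpa using hf) (by simp [hj])
  exact ⟨⟨y, mem_completeIntegralClosure_of_isIntegral hc0 hc hy⟩, rfl⟩

/-- Otherwise `R̄ = K`, and `cK ⊆ R` with `c ≠ 0` forces `R = K`. -/
theorem not_isField_completeIntegralClosure (hR : ¬ IsField R) (h : IsFCDomain R K) :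
    ¬ IsField (completeIntegralClosure R K) := by
  intro hD
  obtain ⟨c, hc, hc0⟩ := h.exists_mem_overringConductor_ne_zero
  have htop (x : K) : x ∈ completeIntegralClosure R K := by
    let := hD.toField
    obtain ⟨y, hy⟩ := (IsFractionRing.surjective_iff_isField (K := K)
      (R := completeIntegralClosure R K)).2 hD x
    exact hy ▸ y.2
  refine hR ((IsFractionRing.surjective_iff_isField (K := K)).1 fun x => ?_)
  have := mem_overringConductor.1 hc (c⁻¹ * x) (htop _)
  rwa [mul_inv_cancel_left₀ hc0] at this

/-! ### Finiteness of the maximal spectrum -/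

/-- The quotient field of an FC-domain is obtained by inverting a single element. -/
theorem IsFCDomain.exists_pow_mul_mem_range (h : IsFCDomain R K) :
    ∃ s : R, s ≠ 0 ∧ ∀ x : K, ∃ n : ℕ, algebraMap R K s ^ n * x ∈ (algebraMap R K).range := by
  obtain ⟨t, ht⟩ := h.fg ⊤
  obtain ⟨s, hs⟩ := IsLocalization.exist_integer_multiples_of_finset R⁰ t
  refine ⟨s, nonZeroDivisors.ne_zero s.2, fun x => ?_⟩
  have hx : x ∈ Algebra.adjoin R (t : Set K) := ht ▸ Algebra.mem_top
  induction hx using Algebra.adjoin_induction with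
  | mem x hx =>
    obtain ⟨r, hr⟩ := hs x hx
    exact ⟨1, r, by rw [hr, pow_one, Algebra.smul_def]⟩
  | algebraMap r => exact ⟨0, r, by simp⟩
  | add x y _ _ hx hy =>
    obtain ⟨m, hm⟩ := hx
    obtain ⟨n, hn⟩ := hy
    refine ⟨m + n, ?_⟩
    have : algebraMap R K s ^ (m + n) * (x + y) = algebraMap R K s ^ n *
        (algebraMap R K s ^ m * x) + algebraMap R K s ^ m * (algebraMap R K s ^ n * y) := by ring
    have hs' (k : ℕ) : algebraMap R K s ^ k ∈ (algebraMap R K).range :=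
      ⟨(s : R) ^ k, map_pow _ _ _⟩
    rw [this]
    exact add_mem (mul_mem (hs' n) hm) (mul_mem (hs' m) hn)
  | mul x y _ _ hx hy =>
    obtain ⟨m, hm⟩ := hx
    obtain ⟨n, hn⟩ := hy
    refine ⟨m + n, ?_⟩
    have : algebraMap R K s ^ (m + n) * (x * y) =
        (algebraMap R K s ^ m * x) * (algebraMap R K s ^ n * y) := by ring
    rw [this]
    exact mul_mem hm hn

/-- A Dedekind overring of an FC-domain has only finitely many maximal ideals. -/
theorem IsFCDomain.finite_maximalSpectrum (h : IsFCDomain R K) (T : Subalgebra R K)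
    [IsDedekindDomain T] (hT : ¬ IsField T) : Finite (MaximalSpectrum T) := by
  obtain ⟨s, hs0, hs⟩ := h.exists_pow_mul_mem_range
  have hinj : Function.Injective (algebraMap R T) := fun a b hab =>
    IsFractionRing.injective R K (congrArg Subtype.val hab)
  have hbot (P : MaximalSpectrum T) : P.asIdeal ≠ ⊥ := Ring.ne_bot_of_isMaximal_of_not_isField P.2 hT
  -- For `0 ≠ p ∈ P`, some `sⁿ p⁻¹` lies in `R`, so `sⁿ ∈ pT ⊆ P`. Only finitely many primes divide
  -- `s`.
  have hmem (P : MaximalSpectrum T) : algebraMap R T s ∈ P.asIdeal := by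
    obtain ⟨p, hp, hp0⟩ := Submodule.exists_mem_ne_zero_of_ne_bot (hbot P)
    obtain ⟨n, a, ha⟩ := hs (p : K)⁻¹
    have hp0' : (p : K) ≠ 0 := fun h => hp0 (Subtype.ext h)
    have : algebraMap R T s ^ n = algebraMap R T a * p := Subtype.ext <| by
      change algebraMap R K s ^ n = algebraMap R K a * p
      rw [ha, inv_mul_cancel_right₀ hp0']
    exact P.2.isPrime.mem_of_pow_mem n (this ▸ P.asIdeal.mul_mem_left _ hp)
  have hfin := Ideal.finite_factors (I := Ideal.span {algebraMap R T s})
    (by simpa using (map_ne_zero_iff _ hinj).2 hs0)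
  have := hfin.to_subtype
  refine Finite.of_injective (β := {v : IsDedekindDomain.HeightOneSpectrum T |
      v.asIdeal ∣ Ideal.span {algebraMap R T s}})
    (fun P => ⟨⟨P.asIdeal, P.2.isPrime, hbot P⟩, ?_⟩) fun P Q hPQ => ?_
  · exact Ideal.dvd_iff_le.2 ((Ideal.span_singleton_le_iff_mem _).2 (hmem P))
  · simp only [Subtype.mk.injEq, IsDedekindDomain.HeightOneSpectrum.mk.injEq] at hPQ
    exact MaximalSpectrum.ext hPQ

end

/-! ### Integrality of the complete integral closure -/

section

variable {R K : Type*} [CommRing R] [IsDomain R] [Field K] [Algebra R K] [IsFractionRing R K]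

/-- In a Mori domain, the descending chain of the ideals `{r ∈ R | r, r x, …, r xⁿ ∈ R}` is
stationary if `x` is almost integral. -/
theorem IsMoriDomain.exists_forall_mul_pow_mem (hM : IsMoriDomain R K) {c x : K} (hc0 : c ≠ 0)
    (hc : c ∈ overringConductor R K (completeIntegralClosure R K))
    (hx : x ∈ completeIntegralClosure R K) :
    ∃ N : ℕ, ∀ r : R, (∀ i ≤ N, algebraMap R K r * x ^ i ∈ (algebraMap R K).range) →
      ∀ i, algebraMap R K r * x ^ i ∈ (algebraMap R K).range := by
  have hcx (i : ℕ) : c * x ^ i ∈ (algebraMap R K).range :=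
    mem_overringConductor.1 hc _ (pow_mem hx i)
  let S (n : ℕ) : Set K := {z | ∃ r : R,
    (∀ i ≤ n, algebraMap R K r * x ^ i ∈ (algebraMap R K).range) ∧ z = c⁻¹ * algebraMap R K r}
  -- With `Iₙ = {r | r, r x, …, r xⁿ ∈ R}`, this is `R ∩ c Iₙ⁻¹`: dualizing makes the chain ascend,
  -- and the factor `c` brings `c xⁿ` into `J n`.
  let J (n : ℕ) : Ideal R :=
    { carrier := {y | ∀ z ∈ S n, algebraMap R K y * z ∈ (algebraMap R K).range}
      zero_mem' := fun z _ => by simp [zero_mem]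
      add_mem' := fun ha hb z hz => by
        rw [map_add, add_mul]
        exact add_mem (ha z hz) (hb z hz)
      smul_mem' := fun a b hb z hz => by
        rw [smul_eq_mul, map_mul, mul_assoc]
        exact mul_mem ⟨a, rfl⟩ (hb z hz) }
  have hJ (n : ℕ) (y : R) :
      y ∈ J n ↔ ∀ z ∈ S n, algebraMap R K y * z ∈ (algebraMap R K).range := Iff.rfl
  have hcxJ (n : ℕ) : ∃ y ∈ J n, algebraMap R K y = c * x ^ n := by
    obtain ⟨y, hy⟩ := hcx n
    refine ⟨y, (hJ _ _).2 ?_, hy⟩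
    rintro _ ⟨r, hr, rfl⟩
    have : algebraMap R K y * (c⁻¹ * algebraMap R K r) = algebraMap R K r * x ^ n := by
      rw [hy]
      field_simp
    rw [this]
    exact hr n le_rfl
  have hmono : Monotone J := by
    intro m n hmn y hy
    rw [hJ] at hy ⊢
    rintro _ ⟨r, hr, rfl⟩
    exact hy _ ⟨r, fun i hi => hr i (hi.trans hmn), rfl⟩
  have hbot (n : ℕ) : J n ≠ ⊥ := fun h => by
    obtain ⟨y, hy, hyc⟩ := hcxJ 0
    have hy := hmono (Nat.zero_le n) hy
    rw [h, Ideal.mem_bot] at hy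
    rw [hy, map_zero, pow_zero, mul_one] at hyc
    exact hc0 hyc.symm
  obtain ⟨N, hN⟩ := hM ⟨J, hmono⟩ fun n => isVIdeal_of_mem_iff (hbot n) (S n) (hJ n)
  refine ⟨N, fun r hr i => ?_⟩
  rcases le_total i N with hi | hi
  · exact hr i hi
  · obtain ⟨y, hy, hyc⟩ := hcxJ i
    have hiN : J i = J N := hN i hi
    rw [hiN] at hy
    have := (hJ _ _).1 hy _ ⟨r, hr, rfl⟩
    rw [hyc] at this
    convert this using 1
    field_simp

theorem pow_mul_pow_eq_of_sq_mul_eq {A : Type*} [CommRing A] {b y : A} (h : b ^ 2 * y = b)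
    (j i : ℕ) : b ^ (j + 1 + i) * y ^ i = b ^ (j + 1) := by
  induction i generalizing j with
  | zero => simp
  | succ i ih =>
    calc b ^ (j + 1 + (i + 1)) * y ^ (i + 1) = (b ^ (j + 1 + 1 + i) * y ^ i) * y := by ring
      _ = b ^ j * (b ^ 2 * y) := by rw [ih]; ring
      _ = b ^ (j + 1) := by rw [h, pow_succ]

theorem IsArtinianRing.exists_pow_sq_mul_eq {A : Type*} [CommRing A] [IsArtinianRing A] (a : A) :
    ∃ k ≠ 0, ∃ y, (a ^ k) ^ 2 * y = a ^ k := by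
  obtain ⟨n, y, hy⟩ := IsArtinian.exists_pow_succ_smul_dvd a (1 : A)
  simp only [smul_eq_mul, mul_one] at hy
  have h (i : ℕ) : a ^ (n + i) * y ^ i = a ^ n := by
    induction i with
    | zero => simp
    | succ i ih =>
      calc a ^ (n + (i + 1)) * y ^ (i + 1) = (a ^ (n + 1) * y) * (a ^ i * y ^ i) := by ring
        _ = a ^ (n + i) * y ^ i := by rw [hy]; ring
        _ = a ^ n := ih
  refine ⟨n + 1, n.succ_ne_zero, y ^ (n + 1), ?_⟩
  calc (a ^ (n + 1)) ^ 2 * y ^ (n + 1) = a * (a ^ (n + (n + 1)) * y ^ (n + 1)) := by ring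
    _ = a ^ (n + 1) := by rw [h]; ring

/-- The ring `R / (R : R̄)` is zero-dimensional if `R` is a Mori domain with nonzero conductor and
`R̄` is a Dedekind domain. -/
theorem IsMoriDomain.exists_pow_mul_one_sub_mem (hM : IsMoriDomain R K) {c : K} (hc0 : c ≠ 0)
    (hc : c ∈ overringConductor R K (completeIntegralClosure R K))
    [IsDedekindDomain (completeIntegralClosure R K)] (a : R) :
    ∃ k ≠ 0, ∃ e : R, algebraMap R K (a ^ k * (1 - a ^ k * e)) ∈
      overringConductor R K (completeIntegralClosure R K) := by
  obtain ⟨c', hc'⟩ := mem_range_of_mem_overringConductor hc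
  let D := completeIntegralClosure R K
  let γ : D := algebraMap R D c'
  have hγ : (γ : K) = c := hc'
  have hcoe (r : R) : (algebraMap R D r : K) = algebraMap R K r := rfl
  have hγ0 : γ ≠ 0 := fun h => hc0 (hγ ▸ congrArg Subtype.val h)
  have := ((isFiniteLength_iff_isNoetherian_isArtinian).1
    (isFiniteLength_quotient_span_singleton D (mem_nonZeroDivisors_of_ne_zero hγ0))).2
  have : IsArtinianRing (D ⧸ Ideal.span {γ}) := isArtinian_of_tower D this
  let π := Ideal.Quotient.mk (Ideal.span {γ})
  have hπ (u v : D) (h : π u = π v) : (u : K) - v ∈ overringConductor R K D := by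
    obtain ⟨d, hd⟩ := Ideal.mem_span_singleton.1 (Ideal.Quotient.eq.1 h)
    have : (u : K) - v = c * d := by
      rw [← hγ]
      exact congrArg Subtype.val hd
    rw [this]
    exact mul_mem_overringConductor hc d.2
  obtain ⟨k, hk, y, hy⟩ := IsArtinianRing.exists_pow_sq_mul_eq (π (algebraMap R D a))
  obtain ⟨y, rfl⟩ := Ideal.Quotient.mk_surjective y
  rw [← map_pow] at hy
  have hyD := pow_mul_pow_eq_of_sq_mul_eq hy
  obtain ⟨N, hN⟩ := hM.exists_forall_mul_pow_mem hc0 hc y.2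
  -- Put `b = a ^ k`, so `b² y ≡ b` modulo `γD ⊆ C`. For `i ≤ N`, `b^(N+1) yⁱ` is congruent to a
  -- power of `b`, hence lies in `R`; by the choice of `N` this extends to all `i`.
  have hmem := hN ((a ^ k) ^ (N + 1)) fun i hi => by
    obtain ⟨j, rfl⟩ := Nat.exists_eq_add_of_le hi
    have h1 := hyD j i
    simp only [← map_pow] at h1
    have h2 := mem_range_of_mem_overringConductor (hπ _ _ h1)
    have h3 := add_mem h2 (⟨(a ^ k) ^ (j + 1), rfl⟩ :
      algebraMap R K ((a ^ k) ^ (j + 1)) ∈ (algebraMap R K).range)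
    convert h3 using 1
    simp only [MulMemClass.coe_mul, SubmonoidClass.coe_pow, hcoe, map_pow]
    ring
  -- With `e = b^(N+1) y^(N+2)`, `b² e = b^(N+3) y^(N+2) ≡ b`.
  obtain ⟨e, he⟩ := hmem (N + 2)
  refine ⟨k, hk, e, ?_⟩
  have h1 := hyD 0 (N + 2)
  simp only [← map_pow] at h1
  have h2 := hπ _ _ h1.symm
  convert h2 using 1
  simp only [map_mul, map_sub, map_one, he, MulMemClass.coe_mul, SubmonoidClass.coe_pow, hcoe,
    map_pow]
  ring

/-- Some `r^k (1 - r^k e)` lies in `C`, and its second factor is a `v`-unit. Multiplying by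
`x^((i+1)k)` stays in `R`, so `v (r x^(i+1)) ≤ 1`; the spare factor `v x > 1` makes the bound at `i`
strict. -/
theorem IsMoriDomain.mul_pow_lt_one (hM : IsMoriDomain R K) {c : K} (hc0 : c ≠ 0)
    (hc : c ∈ overringConductor R K (completeIntegralClosure R K))
    [IsDedekindDomain (completeIntegralClosure R K)] {Γ : Type*}
    [LinearOrderedCommGroupWithZero Γ] (v : Valuation K Γ) (hv : ∀ r : R, v (algebraMap R K r) ≤ 1)
    {x : K} (hx : x ∈ completeIntegralClosure R K) (hvx : 1 < v x) {r : R}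
    (hr : v (algebraMap R K r) < 1) (i : ℕ) : v (algebraMap R K r * x ^ i) < 1 := by
  obtain ⟨k, hk, e, he⟩ := hM.exists_pow_mul_one_sub_mem hc0 hc r
  have h1 : v (1 - algebraMap R K (r ^ k * e)) = 1 := by
    refine v.map_one_sub_of_lt ?_
    rw [map_mul, map_mul, map_pow, map_pow]
    exact mul_lt_one_of_lt_of_le (pow_lt_one₀ zero_le hr hk) (hv e)
  have h2 : v (algebraMap R K r * x ^ (i + 1)) ^ k ≤ 1 := by
    obtain ⟨s, hs⟩ := mem_overringConductor.1 he _ (pow_mem hx ((i + 1) * k))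
    have hs' : algebraMap R K s =
        (algebraMap R K r * x ^ (i + 1)) ^ k * (1 - algebraMap R K (r ^ k * e)) := by
      rw [hs, pow_mul]
      simp only [map_mul, map_sub, map_one, map_pow]
      ring
    have := hv s
    rwa [hs', map_mul, h1, mul_one, map_pow] at this
  have h3 : v (algebraMap R K r * x ^ i) * v x ≤ 1 := by
    rw [← map_mul, mul_assoc, ← pow_succ]
    exact (pow_le_one_iff_of_nonneg zero_le hk).1 h2
  by_contra! h4
  exact absurd (h3.trans_lt hvx) (not_lt.2 (le_mul_of_one_le_left zero_le h4))

/-- Let `v` be a valuation of `K`, nonnegative on `R`, and let `v x > 1`. If `v (r xⁱ) < 1` for all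
`i` and all `r ∈ R` with `v r < 1`, then `x` is not a root of a polynomial over `R` having a
coefficient which is a unit for `v`. -/
theorem Valuation.aeval_ne_zero_of_forall_mul_pow_lt_one {R K Γ : Type*} [CommRing R] [Field K]
    [Algebra R K] [LinearOrderedCommGroupWithZero Γ] (v : Valuation K Γ)
    (hv : ∀ r : R, v (algebraMap R K r) ≤ 1) {x : K} (hvx : 1 < v x)
    (h : ∀ r : R, v (algebraMap R K r) < 1 → ∀ i : ℕ, v (algebraMap R K r * x ^ i) < 1)
    {f : Polynomial R} {j : ℕ} (hj : f.coeff j = 1) : Polynomial.aeval x f ≠ 0 := by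
  classical
  intro hf
  let S := (Finset.range (f.natDegree + 1)).filter fun i => v (algebraMap R K (f.coeff i)) = 1
  have hne : S.Nonempty := by
    refine ⟨j, Finset.mem_filter.2 ⟨Finset.mem_range.2 (Nat.lt_succ_of_le ?_), by simp [hj]⟩⟩
    by_cases hR : Nontrivial R
    · exact Polynomial.le_natDegree_of_ne_zero (by simp [hj])
    · rw [not_nontrivial_iff_subsingleton] at hR
      have := (algebraMap R K).map_one
      rw [Subsingleton.elim (1 : R) 0, map_zero] at this
      exact absurd this zero_ne_one
  obtain ⟨m, hm, hmax⟩ := S.exists_max_image id hne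
  obtain ⟨hmr, hm1⟩ := Finset.mem_filter.1 hm
  rw [Polynomial.aeval_eq_sum_range, ← Finset.add_sum_erase _ _ hmr, add_eq_zero_iff_eq_neg] at hf
  -- The last unit coefficient, at `m`, dominates: lower terms have smaller powers of `v x`, higher
  -- ones have value below `1` by `h`.
  have hlt : v (∑ i ∈ (Finset.range (f.natDegree + 1)).erase m, f.coeff i • x ^ i) < v x ^ m := by
    refine v.map_sum_lt (pow_ne_zero _ (zero_lt_one.trans hvx).ne') fun i hi => ?_
    obtain ⟨him, hir⟩ := Finset.mem_erase.1 hi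
    rw [Algebra.smul_def]
    rcases lt_or_gt_of_ne him with hlt | hlt
    · rw [map_mul, map_pow]
      exact (mul_le_of_le_one_left zero_le (hv _)).trans_lt (pow_lt_pow_right₀ hvx hlt)
    · refine (h _ (lt_of_le_of_ne (hv _) fun h1 => ?_) i).trans_le (one_le_pow₀ hvx.le)
      exact absurd (hmax i (Finset.mem_filter.2 ⟨hir, h1⟩)) (not_le.2 hlt)
  rw [← v.map_neg, ← hf, Algebra.smul_def, map_mul, hm1, one_mul, map_pow] at hlt
  exact lt_irrefl _ hlt

/-- The complete integral closure of a Mori FC-domain is its integral closure. -/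
theorem isIntegral_of_mem_completeIntegralClosure (hM : IsMoriDomain R K) (h : IsFCDomain R K)
    {x : K} (hx : x ∈ completeIntegralClosure R K) : IsIntegral R x := by
  obtain ⟨c, hc, hc0⟩ := h.exists_mem_overringConductor_ne_zero
  have := isDedekindDomain_completeIntegralClosure hM h
  by_contra hxi
  have : IsIntegrallyClosedIn (integralClosure R K).toSubring K :=
    Subring.isIntegrallyClosedIn_iff.2 fun {y} hy =>
      isIntegral_trans (A := integralClosure R K) y hy
  obtain ⟨V, hV, hxV⟩ := Subring.exists_le_valuationSubring_of_isIntegrallyClosedIn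
    (R := (integralClosure R K).toSubring) hxi
  have hv (r : R) : V.valuation (algebraMap R K r) ≤ 1 :=
    (V.valuation_le_one_iff _).2 (hV ((integralClosure R K).algebraMap_mem r))
  have hvx : 1 < V.valuation x := by rwa [← not_le, V.valuation_le_one_iff]
  obtain ⟨f, hf, j, hj⟩ := h.exists_aeval_eq_zero x
  exact V.valuation.aeval_ne_zero_of_forall_mul_pow_lt_one hv hvx
    (fun r hr => hM.mul_pow_lt_one hc0 hc V.valuation hv hx hvx hr) hj hf

end

/-! ### Krull dimension and integral extensions -/

theorem Ring.DimensionLEOne.ringKrullDim_le_one (A : Type*) [CommRing A]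
    [Ring.DimensionLEOne A] : ringKrullDim A ≤ 1 := by
  rw [← Nat.cast_one, ← Ring.krullDimLE_iff]
  infer_instance

theorem ValuationRing.isIntegrallyClosed_of_isDomain (A : Type*) [CommRing A] [IsDomain A]
    [ValuationRing A] : IsIntegrallyClosed A :=
  inferInstance

theorem Ring.DimensionLEOne.ringKrullDim_eq_one {A : Type*} [CommRing A] [IsDomain A]
    [Ring.DimensionLEOne A] (hA : ¬ IsField A) : ringKrullDim A = 1 := by
  refine eq_of_le_of_not_lt (Ring.DimensionLEOne.ringKrullDim_le_one A) fun h => hA ?_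
  have h' : ringKrullDim A ≤ 0 := Order.le_of_lt_succ h
  rw [← Nat.cast_zero, ← Ring.krullDimLE_iff] at h'
  exact Ring.KrullDimLE.isField_of_isDomain

theorem Ring.DimensionLEOne.of_isIntegral_of_injective {A B : Type*} [CommRing A] [CommRing B]
    [Algebra A B] [Algebra.IsIntegral A B] [Ring.DimensionLEOne B]
    (h : Function.Injective (algebraMap A B)) : Ring.DimensionLEOne A := by
  refine ⟨fun {P} hP0 hP => ?_⟩
  obtain ⟨Q, -, hQ, rfl⟩ := Ideal.exists_ideal_over_prime_of_isIntegral P (⊥ : Ideal B) (by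
    rw [← RingHom.ker_eq_comap_bot, (RingHom.injective_iff_ker_eq_bot _).1 h]
    exact bot_le)
  have := hQ.isMaximal (fun h0 => hP0 (by
    rw [h0, ← RingHom.ker_eq_comap_bot, (RingHom.injective_iff_ker_eq_bot _).1 h]))
  exact Ideal.isMaximal_comap_of_isIntegral_of_isMaximal Q

/-! ### Descent of the Noetherian property -/

/-- Induction on irreducible factors along `B/a → B/(ia) → B/i`, whose last term is
finite-dimensional over a residue field of `A`. -/
theorem IsNoetherian.quotient_span_singleton {A B : Type*} [CommRing A] [CommRing B] [Algebra A B]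
    [Module.Finite A B] [IsDomain B] [IsPrincipalIdealRing B] (d : B) (hd : d ≠ 0) :
    IsNoetherian A (B ⧸ Ideal.span {d}) := by
  induction d using WfDvdMonoid.induction_on_irreducible with
  | zero => exact absurd rfl hd
  | unit u hu =>
    have : Subsingleton (B ⧸ Ideal.span {u}) :=
      Ideal.Quotient.subsingleton_iff.2 (Ideal.span_singleton_eq_top.2 hu)
    infer_instance
  | mul a i ha0 hi ih =>
    have := ih ha0
    have hmax : (Ideal.span {i}).IsMaximal := PrincipalIdealRing.isMaximal_of_irreducible hi
    have hmax' := Ideal.isMaximal_comap_of_isIntegral_of_isMaximal (R := A) (Ideal.span {i})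
    let := Ideal.Quotient.field ((Ideal.span {i}).comap (algebraMap A B))
    have hfin : Module.Finite (A ⧸ (Ideal.span {i}).comap (algebraMap A B)) (B ⧸ Ideal.span {i}) :=
      Module.Finite.of_restrictScalars_finite A _ _
    have : IsNoetherian A (B ⧸ Ideal.span {i}) := by
      have h1 : IsNoetherian (A ⧸ (Ideal.span {i}).comap (algebraMap A B)) (B ⧸ Ideal.span {i}) :=
        inferInstance
      have h2 := Submodule.orderIsoOfAlgebraMapSurjective (R := A)
        (S := A ⧸ (Ideal.span {i}).comap (algebraMap A B)) (M := B ⧸ Ideal.span {i})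
        Ideal.Quotient.mk_surjective
      rw [isNoetherian_iff'] at h1 ⊢
      exact h2.symm.toOrderEmbedding.wellFoundedGT
    let f : (B ⧸ Ideal.span {a}) →ₗ[B] (B ⧸ Ideal.span {i * a}) :=
      Submodule.mapQ _ _ (LinearMap.mulLeft B i) (by
        rw [Ideal.span, Submodule.span_le, Set.singleton_subset_iff]
        exact Ideal.mem_span_singleton_self (i * a))
    let g : (B ⧸ Ideal.span {i * a}) →ₗ[B] (B ⧸ Ideal.span {i}) :=
      Submodule.factor (Ideal.span_singleton_le_span_singleton.2 (dvd_mul_right i a))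
    refine isNoetherian_of_range_eq_ker (f.restrictScalars A) (g.restrictScalars A) ?_
    ext x
    obtain ⟨x, rfl⟩ := Ideal.Quotient.mk_surjective x
    constructor
    · rintro ⟨y, hy⟩
      obtain ⟨y, rfl⟩ := Ideal.Quotient.mk_surjective y
      rw [← hy]
      exact Ideal.Quotient.eq_zero_iff_mem.2 (Ideal.mem_span_singleton.2 (dvd_mul_right i y))
    · intro hx
      obtain ⟨y, rfl⟩ := Ideal.mem_span_singleton.1 (Ideal.Quotient.eq_zero_iff_mem.1 hx)
      exact ⟨Ideal.Quotient.mk _ y, rfl⟩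

/-- The Eakin–Nagata theorem for a principal ideal domain which is finite over a subring with
nonzero conductor. -/
theorem IsNoetherianRing.of_finite_of_conductor {A B : Type*} [CommRing A] [CommRing B]
    [Algebra A B] [Module.Finite A B] [IsDomain B] [IsPrincipalIdealRing B]
    (hinj : Function.Injective (algebraMap A B)) {c : B} (hc0 : c ≠ 0)
    (hc : ∀ b, c * b ∈ (algebraMap A B).range) : IsNoetherianRing A := by
  refine (isNoetherianRing_iff_ideal_fg A).2 fun I => ?_
  rcases eq_or_ne I ⊥ with rfl | hI
  · exact Submodule.fg_bot
  obtain ⟨t, htI, ht0⟩ := Submodule.exists_mem_ne_zero_of_ne_bot hI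
  -- Since `cB ⊆ A`, the image of `I` contains `dB`, which is finite over `A`; the rest of `I` sits
  -- in the Noetherian module `B/dB`.
  set d : B := algebraMap A B t * c with hd
  have hd0 : d ≠ 0 := mul_ne_zero ((map_ne_zero_iff _ hinj).2 ht0) hc0
  have hN := IsNoetherian.quotient_span_singleton (A := A) d hd0
  let J : Submodule A B := Submodule.map (Algebra.linearMap A B) I
  let q : B →ₗ[A] (B ⧸ Ideal.span {d}) := (Ideal.Quotient.mkₐ A _).toLinearMap
  have hker : LinearMap.ker q ≤ J := fun x hx => by
    obtain ⟨y, rfl⟩ := Ideal.mem_span_singleton.1 (Ideal.Quotient.eq_zero_iff_mem.1 hx)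
    obtain ⟨a, ha⟩ := hc y
    refine ⟨t * a, I.mul_mem_right _ htI, ?_⟩
    rw [Algebra.linearMap_apply, map_mul, ha, hd, mul_assoc]
  have hJ : J.FG := by
    refine Submodule.fg_of_fg_map_of_fg_inf_ker q (IsNoetherian.noetherian _) ?_
    rw [inf_eq_right.2 hker]
    have : LinearMap.ker q = LinearMap.range (LinearMap.mulLeft A d) := by
      ext x
      refine (Ideal.Quotient.eq_zero_iff_mem.trans Ideal.mem_span_singleton).trans ?_
      exact ⟨fun ⟨y, hy⟩ => ⟨y, hy.symm⟩, fun ⟨y, hy⟩ => ⟨y, hy.symm⟩⟩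
    rw [this]
    exact Module.Finite.iff_fg.1 (Module.Finite.range _)
  exact Submodule.fg_of_fg_map_injective (Algebra.linearMap A B) hinj hJ

/-! ### Valuation overrings and the valuative dimension -/

section

variable {R K : Type*} [CommRing R] [IsDomain R] [Field K] [Algebra R K] [IsFractionRing R K]

/-- Nonzero primes `P ⊆ M` of `V` have the same contraction to `D`. For `t ∈ M` write `1 = b + b' t`
with `b, bt ∈ D`: then `b ∉ M`, while `bt ∈ M ∩ D = P ∩ D`, so `t ∈ P`. -/
theorem IsFCDomain.dimensionLEOne_of_le (h : IsFCDomain R K) {D V : Subalgebra R K} (hDV : D ≤ V)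
    [IsDedekindDomain D] : Ring.DimensionLEOne V := by
  refine ⟨fun {P} hP0 hP => ?_⟩
  obtain ⟨M, hM, hPM⟩ := P.exists_le_maximal hP.ne_top
  suffices M ≤ P from le_antisymm this hPM ▸ hM
  intro t ht
  let ι : D →+* V := (Subalgebra.inclusion hDV).toRingHom
  have hcomap : P.comap ι ≠ ⊥ := by
    obtain ⟨p, hp, hp0⟩ := Submodule.exists_mem_ne_zero_of_ne_bot hP0
    obtain ⟨a, b, hb, hab⟩ := IsFractionRing.div_surjective (A := R) (p : K)
    have hb0 : algebraMap R K b ≠ 0 :=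
      IsFractionRing.to_map_ne_zero_of_mem_nonZeroDivisors hb
    have hab' : algebraMap R V a = p * algebraMap R V b := Subtype.ext <| by
      change algebraMap R K a = p * algebraMap R K b
      rw [← hab, div_mul_cancel₀ _ hb0]
    have ha : algebraMap R D a ∈ P.comap ι := by
      change algebraMap R V a ∈ P
      rw [hab']
      exact P.mul_mem_right _ hp
    intro hbot
    rw [hbot, Ideal.mem_bot] at ha
    have ha : algebraMap R K a = 0 := congrArg Subtype.val ha
    rw [ha, zero_div] at hab
    exact hp0 (Subtype.ext hab.symm)
  have heq : P.comap ι = M.comap ι :=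
    ((hP.comap ι).isMaximal hcomap).eq_of_le (hM.isPrime.comap ι).ne_top (Ideal.comap_mono hPM)
  obtain ⟨f, hf, j, hj⟩ := h.exists_aeval_eq_zero (t : K)
  obtain ⟨b, b', ⟨⟨b, rfl⟩, ⟨u, hu⟩⟩, ⟨⟨b', rfl⟩, ⟨u', hu'⟩⟩, he⟩ :=
    exists_eq_add_mul_of_aeval_eq_zero (A := D) (fun y hy => IsIntegrallyClosed.isIntegral_iff.1 hy)
      (t : K) _ (f.map (algebraMap R D)) le_rfl (by simpa using hf) j
  have hu1 : ι u = ι b * t := Subtype.ext hu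
  have hu1' : ι u' = ι b' * t := Subtype.ext hu'
  have he1 : ι b + ι b' * t = 1 := Subtype.ext <| by
    rwa [Polynomial.coeff_map, hj, map_one, map_one] at he
  have hbM : ι b ∉ M := fun hb =>
    hM.ne_top ((Ideal.eq_top_iff_one M).2 (he1 ▸ add_mem hb (M.mul_mem_left _ ht)))
  have huP : u ∈ P.comap ι := by
    rw [heq, Ideal.mem_comap, hu1]
    exact M.mul_mem_left _ ht
  rw [Ideal.mem_comap, hu1] at huP
  exact (hP.mem_or_mem huP).resolve_left fun hb => hbM (hPM hb)

/-- A nonzero nonunit of `R` remains a nonunit in a suitable valuation ring. -/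
theorem exists_valuationRing_not_isField (K : Type*) [Field K] [Algebra R K] [IsFractionRing R K]
    (hR : ¬ IsField R) :
    ∃ V : Subalgebra R K, ValuationRing V ∧ ¬ IsField V := by
  obtain ⟨r, hr0, hr⟩ := Ring.exists_not_isUnit_of_not_isField hR
  have hinj := IsFractionRing.injective R K
  let r' : (algebraMap R K).range := ⟨algebraMap R K r, r, rfl⟩
  obtain ⟨B, hB, hB'⟩ := Ideal.image_subset_nonunits_valuationSubring (Ideal.span {r'}) (by
    rw [Ne, Ideal.span_singleton_eq_top]
    intro hu
    obtain ⟨⟨_, s, rfl⟩, hs⟩ := hu.exists_right_inv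
    refine hr (IsUnit.of_mul_eq_one s (hinj ?_))
    simpa using congrArg Subtype.val hs)
  have hrB : algebraMap R K r ∈ B.nonunits := hB' ⟨r', Ideal.mem_span_singleton_self _, rfl⟩
  let V : Subalgebra R K := { B.toSubring with algebraMap_mem' := fun r => hB ⟨r, rfl⟩ }
  refine ⟨V, inferInstanceAs (ValuationRing B), fun hV => ?_⟩
  have hr' : algebraMap R V r ≠ 0 := fun h =>
    hr0 (hinj (by simpa using congrArg Subtype.val h))
  obtain ⟨y, hy⟩ := hV.mul_inv_cancel hr'
  have hy1 : B.valuation (y : K) ≤ 1 := (B.valuation_le_one_iff _).2 y.2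
  have hy2 : algebraMap R K r * (y : K) = 1 := congrArg Subtype.val hy
  have := mul_lt_one_of_lt_of_le (B.mem_nonunits_iff.1 hrB) hy1
  rw [← map_mul, hy2, map_one] at this
  exact lt_irrefl _ this

omit [IsDomain R] in
theorem Subalgebra.le_of_valuationRing {D V : Subalgebra R K} (hD : ∀ x ∈ D, IsIntegral R x)
    (hV : ValuationRing V) : D ≤ V := fun x hx => by
  have : IsIntegrallyClosed V := ValuationRing.isIntegrallyClosed_of_isDomain V
  obtain ⟨y, hy⟩ := (IsIntegrallyClosed.isIntegral_iff (R := V) (K := K)).1 ((hD x hx).tower_top (A := V))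
  exact hy ▸ y.2

end

theorem mainTheorem3 (R K : Type*) [CommRing R] [IsDomain R] [Field K] [Algebra R K]
    [IsFractionRing R K] (hR : ¬ IsField R) (hMori : IsMoriDomain R K) (hFC : IsFCDomain R K) :
    (IsDedekindDomain (completeIntegralClosure R K) ∧
      ¬ IsField (completeIntegralClosure R K) ∧
      Finite (MaximalSpectrum (completeIntegralClosure R K))) ∧
    overringConductor R K (completeIntegralClosure R K) ≠ ⊥ ∧
    ringKrullDim R = 1 ∧
    valuativeDim R K = 1 ∧
    ((overringConductor R K (completeIntegralClosure R K)).FG → IsNoetherianRing R) := by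
  have hDed := isDedekindDomain_completeIntegralClosure hMori hFC
  have hnf := not_isField_completeIntegralClosure hR hFC
  have hfin := hFC.finite_maximalSpectrum _ hnf
  obtain ⟨c, hc, hc0⟩ := hFC.exists_mem_overringConductor_ne_zero
  have hint (x : K) (hx : x ∈ completeIntegralClosure R K) : IsIntegral R x :=
    isIntegral_of_mem_completeIntegralClosure hMori hFC hx
  have hint' : Algebra.IsIntegral R (completeIntegralClosure R K) :=
    ⟨fun x => (isIntegral_algHom_iff (completeIntegralClosure R K).val
      Subtype.val_injective).1 (hint x x.2)⟩
  have hinj : Function.Injective (algebraMap R (completeIntegralClosure R K)) := fun a b hab =>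
    IsFractionRing.injective R K (congrArg Subtype.val hab)
  have hdim : Ring.DimensionLEOne R := Ring.DimensionLEOne.of_isIntegral_of_injective hinj
  refine ⟨⟨hDed, hnf, hfin⟩, fun h => hc0 (by rwa [h, Submodule.mem_bot] at hc),
    Ring.DimensionLEOne.ringKrullDim_eq_one hR, le_antisymm (iSup_le fun ⟨V, hV⟩ => ?_) ?_,
    fun _ => ?_⟩
  · have := hFC.dimensionLEOne_of_le (Subalgebra.le_of_valuationRing hint hV)
    exact Ring.DimensionLEOne.ringKrullDim_le_one V
  · obtain ⟨V, hV, hVf⟩ := exists_valuationRing_not_isField (R := R) K hR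
    have := hFC.dimensionLEOne_of_le (Subalgebra.le_of_valuationRing hint hV)
    exact (Ring.DimensionLEOne.ringKrullDim_eq_one hVf).ge.trans
      (le_iSup (fun V : {V : Subalgebra R K // ValuationRing V} => ringKrullDim V.1) ⟨V, hV⟩)
  · have : Algebra.FiniteType R (completeIntegralClosure R K) :=
      (Subalgebra.fg_iff_finiteType _).1 (hFC.fg _)
    have : Module.Finite R (completeIntegralClosure R K) := Algebra.IsIntegral.finite
    -- A semilocal Dedekind domain is a PID.
    have : IsPrincipalIdealRing (completeIntegralClosure R K) :=
      IsPrincipalIdealRing.of_finite_maximals ((MaximalSpectrum.equivSubtype _).finite_iff.1 hfin)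
    obtain ⟨c', rfl⟩ := mem_range_of_mem_overringConductor hc
    refine IsNoetherianRing.of_finite_of_conductor hinj
      (c := algebraMap R (completeIntegralClosure R K) c')
      (fun h => hc0 (congrArg Subtype.val h)) fun b => ?_
    obtain ⟨a, ha⟩ := mem_overringConductor.1 hc b b.2
    exact ⟨a, Subtype.ext ha⟩
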